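/- Let $n,k$ be natural numbers. The cake is $[0,1]$; each player $i\in\{1,\dots,n\}$ has a continuous density $d_i:[0,1]\to[0,\infty)$ with $\int_0^1 d_i=1$, and values a portion $S\subseteq[0,1]$ at $V_i(S)=\int_S d_i(x)\,dx$. Suppose the instance belongs to $X(k)$: there are points $0=t_0<t_1<\dots<t_{nk}=1$ and an assignment of the $nk$ consecutive pieces $[t_{r-1},t_r]$ to the players such that each player $i$ owns exactly $k$ of them, denoted $i_1,\dots,i_k$, and $V_l(i_m)=0$ for all $l\ne i$ and $1\le m\le k$. Then there is an envy-free contiguous allocation of the entire cake in which every player gets at least the value of his most valuable owned piece. That is, there are pairwise disjoint intervals $A_1,\dots,A_n$ with $A_1\cup\dots\cup A_n=[0,1]$ such that $$V_i(A_i)\ge V_i(A_j)\quad\text{for all } i,j,\qquad\text{and}\qquad V_i(A_i)\ge \max_{1\le m\le k}V_i(i_m)\quad\text{for all } i.$$ -/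

import Mathlib

open MeasureTheory Set

/-- A cake cutting instance with `n` players. The cake is the interval `[0,1]`, and every player `i`
has a continuous nonnegative value density on the cake whose total integral is `1`. -/
structure CakeInstance (n : ℕ) where
  density : Fin n → ℝ → ℝ
  continuousOn_density : ∀ i, ContinuousOn (density i) (Icc 0 1)
  density_nonneg : ∀ i, ∀ x ∈ Icc (0 : ℝ) 1, 0 ≤ density i x
  integral_density : ∀ i, ∫ x in Icc (0 : ℝ) 1, density i x = 1

namespace CakeInstance

/-- The value `V_i(S)` that player `i` assigns to a portion `S` of the cake. -/
noncomputable def value {n : ℕ} (I : CakeInstance n) (i : Fin n) (S : Set ℝ) : ℝ :=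
  ∫ x in S, I.density i x

/-- A witness that the instance `I` lies in `X(k)`: the cake is cut at
`0 = bdry 0 < bdry 1 < ⋯ < bdry (n * k) = 1` into `n * k` consecutive pieces, which are arranged
in an arbitrary order `pos`; the piece with label `(i, m)` is the `m`-th of the `k` pieces owned by
player `i`, and it is worth `0` to every other player. -/
structure OwnedPieces {n : ℕ} (I : CakeInstance n) (k : ℕ) where
  bdry : Fin (n * k + 1) → ℝ
  strictMono_bdry : StrictMono bdry
  bdry_zero : bdry 0 = 0
  bdry_last : bdry (Fin.last (n * k)) = 1
  pos : Fin n × Fin k ≃ Fin (n * k)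
  value_eq_zero : ∀ (i : Fin n) (m : Fin k) (l : Fin n), l ≠ i →
    I.value l (Icc (bdry (pos (i, m)).castSucc) (bdry (pos (i, m)).succ)) = 0

/-- The `m`-th piece owned by player `i`. -/
def OwnedPieces.piece {n : ℕ} {I : CakeInstance n} {k : ℕ} (P : I.OwnedPieces k)
    (i : Fin n) (m : Fin k) : Set ℝ :=
  Icc (P.bdry (P.pos (i, m)).castSucc) (P.bdry (P.pos (i, m)).succ)

/-- The value to player `i` of the most valuable piece that he owns
(a maximum over the `k` owned pieces). -/
noncomputable def OwnedPieces.maxPieceValue {n : ℕ} {I : CakeInstance n} {k : ℕ}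
    (P : I.OwnedPieces k) (i : Fin n) : ℝ :=
  ⨆ m : Fin k, I.value i (P.piece i m)

/-- The allocation `A` is envy-free: nobody prefers another player's portion to his own. -/
def EnvyFree {n : ℕ} (I : CakeInstance n) (A : Fin n → Set ℝ) : Prop :=
  ∀ i j, I.value i (A j) ≤ I.value i (A i)

end CakeInstance

/-- A contiguous allocation of the whole cake `[0,1]` to `n` players: the portions are intervals
(order-connected sets), they are mutually disjoint, and together they make up the cake. -/
structure IsContiguousAllocation {n : ℕ} (A : Fin n → Set ℝ) : Prop where
  ordConnected : ∀ i, (A i).OrdConnected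
  disjoint : ∀ i j, i ≠ j → Disjoint (A i) (A j)
  iUnion_eq : ⋃ i, A i = Icc (0 : ℝ) 1

/-!
The alcoves of the affine Weyl group of type `A` tile the simplex of cut vectors, and each alcove
has exactly one vertex of every colour. Let player `c` label the vertices of colour `c` by a
favourite piece; empty pieces are never favourites, so this is a Sperner labelling. Relabelling
one vertex preserves the parity of the number of fully labelled alcoves. Indeed, when the label at
`k` of an alcove is replaced by the new label, the number of `k` for which the labels become
bijective is odd exactly if they were bijective (a determinant identity over `ZMod 2`). Summed
over the alcoves at the vertex, the replacements at the other vertices cancel in pairs, as alcoves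
mirrored in a facet differ in one vertex only. Hence fully labelled alcoves exist at every scale.
In the limit one gets a division in which the favourite pieces are distinct, for arbitrary
continuous valuations.

Let `[p, q]` be a player's most valuable piece. We apply this to valuations that count the part of
a portion inside `[p, q]` twice, until the whole value of `[p, q]` is reached. Two consecutive
cuts inside `[p, q]` bound its owner's portion, as everything between them is worthless to the
others. Moving the owner's cuts outward to `p` and `q` then gives him at least his boosted value,
and takes nothing of value from the others. If at most one cut is inside `[p, q]`, some portion
contains half of its value, and so has boosted value at least that of `[p, q]`.
-/

/-! ### Alcoves and Sperner's lemma -/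

section ParityOfBijections

open Matrix

variable {ι R : Type*} [DecidableEq ι]

theorem one_submatrix_update [Zero R] [One R] (L : ι → ι) (k j : ι) :
    (1 : Matrix ι ι R).submatrix (Function.update L k j) id =
      ((1 : Matrix ι ι R).submatrix L id).updateRow k (Pi.single j 1) := by
  ext x y
  by_cases hx : x = k
  · simp [hx, one_apply, Pi.single_apply, eq_comm]
  · rw [updateRow_ne hx, submatrix_apply, submatrix_apply, Function.update_of_ne hx]

variable [Fintype ι]

theorem sum_det_updateRow_single [CommRing R] {M : Matrix ι ι R} (hM : M *ᵥ 1 = 1) (j : ι) :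
    ∑ k, (M.updateRow k (Pi.single j 1)).det = M.det := by
  calc ∑ k, (M.updateRow k (Pi.single j 1)).det = (M.adjugate *ᵥ 1) j := by
        simp [← adjugate_apply, mulVec, dotProduct]
    _ = (M.adjugate *ᵥ (M *ᵥ 1)) j := by rw [hM]
    _ = M.det := by simp [mulVec_mulVec, adjugate_mul, smul_mulVec]

theorem det_one_submatrix_zmod_two (L : ι → ι) [Decidable (Function.Bijective L)] :
    ((1 : Matrix ι ι (ZMod 2)).submatrix L id).det = if Function.Bijective L then 1 else 0 := by
  split_ifs with hL
  · have hdet := det_permute (Equiv.ofBijective L hL) (1 : Matrix ι ι (ZMod 2))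
    rw [det_one, mul_one] at hdet
    refine hdet.trans ?_
    rcases Int.units_eq_one_or (Equiv.Perm.sign (Equiv.ofBijective L hL)) with h | h <;>
      simp [h]
  · obtain ⟨x, y, hxy, hne⟩ : ∃ x y, L x = L y ∧ x ≠ y := by
      rw [← Finite.injective_iff_bijective] at hL
      simpa [Function.Injective] using hL
    exact det_zero_of_row_eq hne (funext fun z => by rw [submatrix_apply, submatrix_apply, hxy])

theorem sum_ite_bijective_update (L : ι → ι) (j : ι)
    [DecidablePred fun f : ι → ι => Function.Bijective f] :
    ∑ k, (if Function.Bijective (Function.update L k j) then (1 : ZMod 2) else 0) =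
      if Function.Bijective L then 1 else 0 := by
  have hrow : (1 : Matrix ι ι (ZMod 2)).submatrix L id *ᵥ 1 = 1 :=
    funext fun x => by simp [mulVec, dotProduct, one_apply]
  simpa only [← one_submatrix_update, det_one_submatrix_zmod_two] using
    sum_det_updateRow_single hrow j

end ParityOfBijections

namespace Alcove

variable {n : ℕ}

/-- The lattice move that takes one unit from coordinate `i` to its cyclic successor. -/
def transfer (i : ZMod n) : ZMod n → ℤ := Pi.single (i + 1) 1 - Pi.single i 1

theorem transfer_injective : Function.Injective (transfer : ZMod n → ZMod n → ℤ) := by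
  intro i j hij
  by_contra hne
  have : Nontrivial (ZMod n) := ⟨i, j, hne⟩
  have hi := congrFun hij i
  simp only [transfer, Pi.sub_apply, Pi.single_apply, left_eq_add, one_ne_zero, if_neg hne,
    if_true, if_false] at hi
  split_ifs at hi <;> lia

theorem sum_transfer_apply (T : Finset (ZMod n)) (i : ZMod n) :
    (∑ x ∈ T, transfer x) i = (if i - 1 ∈ T then 1 else 0) - if i ∈ T then 1 else 0 := by
  simp [transfer, Finset.sum_apply, Pi.single_apply, Finset.sum_sub_distrib, ← sub_eq_iff_eq_add]

open Classical in
/-- A labelling of the lattice by positive coordinates that avoids the label `0` if possible. -/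
noncomputable def baseLabel (a : ZMod n → ℤ) : ZMod n :=
  if h : ∃ j, j ≠ 0 ∧ 0 < a j then h.choose else 0

theorem apply_baseLabel_pos_of_ne {a : ZMod n → ℤ} (ha : baseLabel a ≠ 0) :
    0 < a (baseLabel a) := by
  unfold baseLabel at ha ⊢
  split_ifs at ha ⊢ with h
  exacts [h.choose_spec.2, absurd rfl ha]

theorem apply_nonpos_of_baseLabel_eq_zero {a : ZMod n → ℤ} (ha : baseLabel a = 0) {i : ZMod n}
    (hi : i ≠ 0) : a i ≤ 0 := by
  by_contra! hpos
  have hex : ∃ j, j ≠ 0 ∧ 0 < a j := ⟨i, hi, hpos⟩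
  rw [baseLabel, dif_pos hex] at ha
  exact hex.choose_spec.1 ha

theorem baseLabel_single_add_single (N : ℤ) (j : ZMod n) :
    baseLabel (Pi.single j 1 + Pi.single 0 (N - 1)) = j := by
  by_contra! hne
  by_cases h0 : baseLabel (Pi.single j 1 + Pi.single 0 (N - 1) : ZMod n → ℤ) = 0
  · have hj : j ≠ 0 := by rwa [h0, ne_comm] at hne
    have := apply_nonpos_of_baseLabel_eq_zero h0 hj
    simp [hj] at this
  · have := apply_baseLabel_pos_of_ne h0
    simp [hne, h0] at this

variable [NeZero n]

/-- A colouring of the lattice that increases by one along every `transfer`; in the fair division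
argument a lattice point of colour `c` is owned by player `c`. -/
def colour (a : ZMod n → ℤ) : ZMod n := ∑ i, i * (a i : ZMod n)

theorem colour_add (a b : ZMod n → ℤ) : colour (a + b) = colour a + colour b := by
  simp [colour, mul_add, Finset.sum_add_distrib]

theorem colour_sub (a b : ZMod n → ℤ) : colour (a - b) = colour a - colour b := by
  simp [colour, mul_sub, Finset.sum_sub_distrib]

theorem colour_single (i : ZMod n) (m : ℤ) : colour (Pi.single i m) = i * m := by
  simp [colour, Pi.single_apply]

end Alcove

/-- An alcove of the affine Weyl group of type `A` in the hyperplane `∑ i, x i = N`, given by its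
vertices. They are listed by colour, and consecutive vertices differ by a transfer, each transfer
being used exactly once around the cycle. -/
@[ext]
structure Alcove (n : ℕ) [NeZero n] (N : ℤ) where
  vertex : ZMod n → ZMod n → ℤ
  exists_perm : ∃ π : Equiv.Perm (ZMod n), ∀ c, vertex (c + 1) = vertex c + Alcove.transfer (π c)
  colour_vertex : ∀ c, Alcove.colour (vertex c) = c
  sum_vertex : ∀ c, ∑ i, vertex c i = N

namespace Alcove

variable {n : ℕ} [NeZero n] {N : ℤ}

theorem exists_vertex_eq_add_sum (A : Alcove n N) (c c' : ZMod n) :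
    ∃ T : Finset (ZMod n), A.vertex c' = A.vertex c + ∑ x ∈ T, transfer x := by
  obtain ⟨π, hπ⟩ := A.exists_perm
  have walk (t : ℕ) :
      A.vertex (c + t) = A.vertex c + ∑ s ∈ Finset.range t, transfer (π (c + s)) := by
    induction t with
    | zero => simp
    | succ t ih => rw [Finset.sum_range_succ, Nat.cast_succ, ← add_assoc, hπ, ih, add_assoc]
  have hinj : Set.InjOn (fun s : ℕ => π (c + s)) (Finset.range (c' - c).val) := by
    refine (π.injective.comp (add_right_injective c)).comp_injOn
      ((CharP.natCast_injOn_Iio (ZMod n) n).mono fun s hs => ?_)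
    exact (Finset.mem_range.1 hs).trans (ZMod.val_lt _)
  refine ⟨(Finset.range (c' - c).val).image fun s : ℕ => π (c + s), ?_⟩
  rw [Finset.sum_image hinj, ← walk, ZMod.natCast_zmod_val, add_sub_cancel]

theorem vertex_le_vertex_add_one (A : Alcove n N) (c c' i : ZMod n) :
    A.vertex c' i ≤ A.vertex c i + 1 := by
  obtain ⟨T, hT⟩ := A.exists_vertex_eq_add_sum c c'
  rw [hT, Pi.add_apply, sum_transfer_apply]
  split_ifs <;> lia

/-- The alcove that shares with `A` all its vertices but the one of colour `k`: that vertex is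
replaced by its mirror image in the opposite facet. -/
def flip [Nontrivial (ZMod n)] (k : ZMod n) (A : Alcove n N) : Alcove n N where
  vertex := Function.update A.vertex k (A.vertex (k - 1) + A.vertex (k + 1) - A.vertex k)
  exists_perm := by
    obtain ⟨π, hπ⟩ := A.exists_perm
    have hk := hπ (k - 1)
    rw [sub_add_cancel] at hk
    refine ⟨π * Equiv.swap (k - 1) k, fun c => ?_⟩
    rw [Equiv.Perm.mul_apply]
    rcases eq_or_ne c k with rfl | hc
    · rw [Equiv.swap_apply_right, Function.update_self, Function.update_of_ne (by simp), hk]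
      abel
    rcases eq_or_ne c (k - 1) with rfl | hc'
    · rw [Equiv.swap_apply_left, sub_add_cancel, Function.update_self, Function.update_of_ne hc,
        hπ k]
      abel
    · rw [Equiv.swap_apply_of_ne_of_ne hc' hc, Function.update_of_ne hc,
        Function.update_of_ne (by rwa [ne_eq, ← eq_sub_iff_add_eq]), hπ]
  colour_vertex c := by
    rcases eq_or_ne c k with rfl | hc
    · simp only [Function.update_self, colour_sub, colour_add, A.colour_vertex]
      ring
    · rw [Function.update_of_ne hc, A.colour_vertex]
  sum_vertex c := by
    rcases eq_or_ne c k with rfl | hc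
    · simp [Finset.sum_sub_distrib, Finset.sum_add_distrib, A.sum_vertex]
    · rw [Function.update_of_ne hc, A.sum_vertex]

section Flip

variable [Nontrivial (ZMod n)] (k : ZMod n) (A : Alcove n N)

theorem flip_vertex_of_ne {c : ZMod n} (hc : c ≠ k) : (flip k A).vertex c = A.vertex c :=
  Function.update_of_ne hc _ _

theorem flip_flip : flip k (flip k A) = A := by
  ext1
  simp [flip]

theorem flip_ne : flip k A ≠ A := by
  intro h
  obtain ⟨π, hπ⟩ := A.exists_perm
  have hk : A.vertex (k - 1) + A.vertex (k + 1) - A.vertex k = A.vertex k := by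
    simpa [flip] using congrFun (congrArg vertex h) k
  have hprev := hπ (k - 1)
  rw [sub_add_cancel] at hprev
  have hπk : transfer (π k) = transfer (π (k - 1)) := by
    rw [← sub_eq_iff_eq_add'.2 (hπ k), ← sub_eq_iff_eq_add'.2 hprev, sub_eq_sub_iff_add_eq_add,
      ← sub_eq_iff_eq_add.1 hk, add_comm]
  exact one_ne_zero (sub_eq_self.1 (π.injective (transfer_injective hπk)).symm)

end Flip

/-- The alcoves having `a` as a vertex. -/
def star (N : ℤ) (a : ZMod n → ℤ) : Set (Alcove n N) := {A | A.vertex (colour a) = a}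

theorem finite_star (a : ZMod n → ℤ) : (star N a).Finite := by
  have hinj : Function.Injective (vertex : Alcove n N → _) := fun _ _ => Alcove.ext
  refine ((Set.finite_Icc (fun _ => a - 1) (fun _ => a + 1)).preimage hinj.injOn).subset
    fun A (hA : A.vertex (colour a) = a) => ⟨fun c i => ?_, fun c i => ?_⟩
  · have := A.vertex_le_vertex_add_one c (colour a) i
    rw [hA] at this
    exact sub_le_iff_le_add.2 this
  · have := A.vertex_le_vertex_add_one (colour a) c i
    rwa [hA] at this

theorem exists_vertex_eq_iff {A : Alcove n N} {a : ZMod n → ℤ} :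
    (∃ c, A.vertex c = a) ↔ A ∈ star N a :=
  ⟨by rintro ⟨c, rfl⟩; simp [star, A.colour_vertex], fun h => ⟨_, h⟩⟩

/-- The alcoves whose vertices carry all labels. -/
def full (N : ℤ) (lab : (ZMod n → ℤ) → ZMod n) : Set (Alcove n N) :=
  {A | Function.Bijective fun c => lab (A.vertex c)}

theorem update_comp_vertex {A : Alcove n N} {a : ZMod n → ℤ} (hA : A ∈ star N a)
    (lab : (ZMod n → ℤ) → ZMod n) (j : ZMod n) :
    (fun c => Function.update lab a j (A.vertex c)) =
      Function.update (fun c => lab (A.vertex c)) (colour a) j := by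
  ext1 c
  rcases eq_or_ne c (colour a) with rfl | hc
  · rw [show A.vertex (colour a) = a from hA, Function.update_self, Function.update_self]
  · have hne : A.vertex c ≠ a := fun h => hc (by rw [← h, A.colour_vertex])
    rw [Function.update_of_ne hne, Function.update_of_ne hc]

open Classical in
theorem sum_star_ite_bijective_update {a : ZMod n → ℤ} {k : ZMod n} (hk : k ≠ colour a)
    (lab : (ZMod n → ℤ) → ZMod n) (j : ZMod n) :
    ∑ A ∈ (finite_star (N := N) a).toFinset,
      (if Function.Bijective (Function.update (fun c => lab (A.vertex c)) k j)
        then (1 : ZMod 2) else 0) = 0 := by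
  have : Nontrivial (ZMod n) := ⟨k, colour a, hk⟩
  have hflip (A : Alcove n N) :
      Function.update (fun c => lab ((flip k A).vertex c)) k j =
        Function.update (fun c => lab (A.vertex c)) k j := by
    ext1 c
    rcases eq_or_ne c k with rfl | hc
    · rw [Function.update_self, Function.update_self]
    · rw [Function.update_of_ne hc, Function.update_of_ne hc, flip_vertex_of_ne k A hc]
  refine Finset.sum_involution (fun A _ => flip k A) (fun A _ => ?_) (fun A _ _ => flip_ne k A)
    (fun A hA => ?_) (fun A _ => flip_flip k A)
  · rw [hflip]
    exact CharTwo.add_self_eq_zero _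
  · rw [Set.Finite.mem_toFinset] at hA ⊢
    exact (flip_vertex_of_ne k A hk.symm).trans hA

open Classical in
theorem ncard_full_inter_star (lab : (ZMod n → ℤ) → ZMod n) (a : ZMod n → ℤ) :
    ((full N lab ∩ star N a).ncard : ZMod 2) =
      ∑ A ∈ (finite_star (N := N) a).toFinset,
        if Function.Bijective (fun c => lab (A.vertex c)) then (1 : ZMod 2) else 0 := by
  rw [Finset.sum_boole, ← Set.ncard_coe_finset]
  congr 2
  ext A
  simp [full, and_comm]

theorem ncard_full_update_inter_star (lab : (ZMod n → ℤ) → ZMod n) (a : ZMod n → ℤ) (j : ZMod n) :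
    ((full N (Function.update lab a j) ∩ star N a).ncard : ZMod 2) =
      (full N lab ∩ star N a).ncard := by
  classical
  rw [ncard_full_inter_star, ncard_full_inter_star]
  simp_rw [← sum_ite_bijective_update (fun _ => lab _) j]
  rw [Finset.sum_comm, Finset.sum_eq_single (colour a)
    (fun k _ hk => sum_star_ite_bijective_update hk lab j) (by simp)]
  refine Finset.sum_congr rfl fun A hA => ?_
  rw [update_comp_vertex ((finite_star a).mem_toFinset.1 hA)]

theorem full_update_diff_star (lab : (ZMod n → ℤ) → ZMod n) (a : ZMod n → ℤ) (j : ZMod n) :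
    full N (Function.update lab a j) \ star N a = full N lab \ star N a := by
  ext A
  refine and_congr_left fun hA => ?_
  have hlab (c : ZMod n) : Function.update lab a j (A.vertex c) = lab (A.vertex c) :=
    Function.update_of_ne (fun h => hA (exists_vertex_eq_iff.1 ⟨c, h⟩)) _ _
  simp only [full, Set.mem_ofPred_eq, hlab]

theorem finite_and_odd_full_update {lab : (ZMod n → ℤ) → ZMod n}
    (h : (full N lab).Finite ∧ Odd (full N lab).ncard) (a : ZMod n → ℤ) (j : ZMod n) :
    (full N (Function.update lab a j)).Finite ∧ Odd (full N (Function.update lab a j)).ncard := by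
  obtain ⟨hfin, hodd⟩ := h
  have hfin' : (full N (Function.update lab a j)).Finite := by
    refine ((hfin.sdiff (t := star N a)).union (finite_star a)).subset ?_
    rw [← full_update_diff_star lab a j, Set.sdiff_union_self]
    exact Set.subset_union_left
  refine ⟨hfin', ?_⟩
  rw [← ZMod.natCast_eq_one_iff_odd] at hodd ⊢
  rw [← Set.ncard_inter_add_ncard_sdiff_eq_ncard _ (star N a) hfin', full_update_diff_star,
    Nat.cast_add, ncard_full_update_inter_star, ← Nat.cast_add,
    Set.ncard_inter_add_ncard_sdiff_eq_ncard _ (star N a) hfin, hodd]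

theorem finite_and_odd_full_of_eqOn_compl {lab lab' : (ZMod n → ℤ) → ZMod n}
    (h : (full N lab).Finite ∧ Odd (full N lab).ncard) (S : Finset (ZMod n → ℤ))
    (hS : ∀ a ∉ S, lab' a = lab a) : (full N lab').Finite ∧ Odd (full N lab').ncard := by
  classical
  induction S using Finset.induction_on generalizing lab' with
  | empty => rwa [show lab' = lab from funext fun a => hS a (by simp)]
  | insert b S _ ih =>
    have hb : ∀ a ∉ S, Function.update lab' b (lab b) a = lab a := by
      intro a ha
      rcases eq_or_ne a b with rfl | hab
      · exact Function.update_self ..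
      · rw [Function.update_of_ne hab, hS a (by simp [hab, ha])]
    simpa using finite_and_odd_full_update (ih hb) b (lab' b)

theorem vertex_nonneg_of_mem_full {lab : (ZMod n → ℤ) → ZMod n}
    (hlab : ∀ a : ZMod n → ℤ, ∑ i, a i = N → 0 < a (lab a)) {A : Alcove n N} (hA : A ∈ full N lab)
    (c i : ZMod n) : 0 ≤ A.vertex c i := by
  obtain ⟨c', rfl⟩ := hA.2 i
  have hpos := hlab _ (A.sum_vertex c')
  have hle := A.vertex_le_vertex_add_one c c' (lab (A.vertex c'))
  lia

theorem le_apply_zero_of_baseLabel_eq_zero {a : ZMod n → ℤ} (hsum : ∑ i, a i = N)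
    (ha : baseLabel a = 0) : N ≤ a 0 := by
  rw [← hsum, ← Finset.add_sum_erase _ _ (Finset.mem_univ 0), add_le_iff_nonpos_right]
  exact Finset.sum_nonpos fun i hi =>
    apply_nonpos_of_baseLabel_eq_zero ha (Finset.ne_of_mem_erase hi)

theorem apply_baseLabel_pos (hN : 0 < N) (a : ZMod n → ℤ) (hsum : ∑ i, a i = N) :
    0 < a (baseLabel a) := by
  by_cases ha : baseLabel a = 0
  · rw [ha]
    exact hN.trans_le (le_apply_zero_of_baseLabel_eq_zero hsum ha)
  · exact apply_baseLabel_pos_of_ne ha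

theorem vertex_eq_of_mem_full_baseLabel (hN : 0 < N) {A : Alcove n N}
    (hA : A ∈ full N baseLabel) (c : ZMod n) :
    A.vertex c = Pi.single c 1 + Pi.single 0 (N - 1) := by
  obtain ⟨d, hd⟩ := hA.2 0
  have hd0 : N ≤ A.vertex d 0 := le_apply_zero_of_baseLabel_eq_zero (A.sum_vertex d) hd
  have hnear : N - 1 ≤ A.vertex c 0 := by linarith [A.vertex_le_vertex_add_one c d 0]
  have hpos := apply_baseLabel_pos hN _ (A.sum_vertex c)
  set j := baseLabel (A.vertex c) with hj
  have hle : ∀ i ∈ Finset.univ,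
      (Pi.single j 1 + Pi.single 0 (N - 1) : ZMod n → ℤ) i ≤ A.vertex c i := by
    intro i _
    have hnonneg := vertex_nonneg_of_mem_full (apply_baseLabel_pos hN) hA c i
    have hfull : j = 0 → N ≤ A.vertex c 0 := fun h =>
      le_apply_zero_of_baseLabel_eq_zero (A.sum_vertex c) (hj.symm.trans h)
    simp only [Pi.add_apply, Pi.single_apply]
    split_ifs <;> grind
  have hsum : ∑ i, (Pi.single j 1 + Pi.single 0 (N - 1) : ZMod n → ℤ) i = ∑ i, A.vertex c i := by
    simp [Finset.sum_add_distrib, A.sum_vertex]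
  have heq : Pi.single j 1 + Pi.single 0 (N - 1) = A.vertex c :=
    funext fun i => (Finset.sum_eq_sum_iff_of_le hle).1 hsum i (Finset.mem_univ i)
  have hjc : j = c := by
    rw [← A.colour_vertex c, ← heq, colour_add, colour_single, colour_single]
    simp
  rw [← heq, hjc]

/-- The alcove with vertices `e_c + (N - 1) e_0` at the corner `N e_0` of the dilated simplex. -/
def corner (n : ℕ) [NeZero n] (N : ℤ) : Alcove n N where
  vertex c := Pi.single c 1 + Pi.single 0 (N - 1)
  exists_perm := ⟨1, fun c => by simp only [transfer, Equiv.Perm.one_apply]; abel⟩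
  colour_vertex c := by simp [colour_add, colour_single]
  sum_vertex c := by simp [Finset.sum_add_distrib]

theorem full_baseLabel (hN : 0 < N) : full N baseLabel = {corner n N} := by
  refine Set.eq_singleton_iff_unique_mem.2 ⟨?_, fun A hA =>
    Alcove.ext (funext (vertex_eq_of_mem_full_baseLabel hN hA))⟩
  simp only [full, corner, Set.mem_ofPred_eq, baseLabel_single_add_single]
  exact Function.bijective_id

/-- Sperner's lemma. The given labels matter only on the finitely many points of the simplex;
outside it they are replaced by `baseLabel`. -/
theorem exists_mem_full (hN : 0 < N) (lab : (ZMod n → ℤ) → ZMod n)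
    (hlab : ∀ a : ZMod n → ℤ, (∀ i, 0 ≤ a i) → ∑ i, a i = N → 0 < a (lab a)) :
    ∃ A ∈ full N lab, ∀ c i, 0 ≤ A.vertex c i := by
  classical
  set S : Finset (ZMod n → ℤ) := Finset.Icc 0 fun _ => N
  let lab' : (ZMod n → ℤ) → ZMod n := fun a => if a ∈ S then lab a else baseLabel a
  have hlab' : ∀ a : ZMod n → ℤ, ∑ i, a i = N → 0 < a (lab' a) := by
    intro a ha
    by_cases haS : a ∈ S
    · simp only [lab', if_pos haS]
      exact hlab a (Finset.mem_Icc.1 haS).1 ha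
    · simp only [lab', if_neg haS]
      exact apply_baseLabel_pos hN a ha
  have hodd : Odd (full N lab').ncard :=
    (finite_and_odd_full_of_eqOn_compl (lab := baseLabel) (by simp [full_baseLabel hN]) S
      fun a ha => if_neg ha).2
  obtain ⟨A, hA⟩ := Set.nonempty_of_ncard_ne_zero hodd.pos.ne'
  have hnonneg := vertex_nonneg_of_mem_full hlab' hA
  have hS (c : ZMod n) : A.vertex c ∈ S := Finset.mem_Icc.2 ⟨hnonneg c, fun i =>
    (Finset.single_le_sum (fun j _ => hnonneg c j) (Finset.mem_univ i)).trans (A.sum_vertex c).le⟩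
  refine ⟨A, ?_, hnonneg⟩
  simpa only [full, Set.mem_ofPred_eq, lab', if_pos (hS _)] using hA

end Alcove

theorem exists_bijective_label_zmod {n : ℕ} [NeZero n] {pref : ZMod n → (ZMod n → ℝ) → ZMod n}
    (hpref : ∀ c, ∀ y ∈ stdSimplex ℝ (ZMod n), 0 < y (pref c y)) {N : ℕ} (hN : 0 < N) :
    ∃ z : ZMod n → ZMod n → ℝ, (∀ c, z c ∈ stdSimplex ℝ (ZMod n)) ∧
      (∀ c c' i, z c' i ≤ z c i + 1 / N) ∧ Function.Bijective fun c => pref c (z c) := by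
  have hN' : (0 : ℝ) < N := Nat.cast_pos.2 hN
  let scale : (ZMod n → ℤ) → ZMod n → ℝ := fun a i => a i / N
  have hscale (a : ZMod n → ℤ) (ha : ∀ i, 0 ≤ a i) (hsum : ∑ i, a i = N) :
      scale a ∈ stdSimplex ℝ (ZMod n) := by
    refine ⟨fun i => div_nonneg (Int.cast_nonneg (ha i)) hN'.le, ?_⟩
    rw [← Finset.sum_div, ← Int.cast_sum, hsum, Int.cast_natCast, div_self hN'.ne']
  obtain ⟨A, hfull, hnonneg⟩ := Alcove.exists_mem_full (Int.natCast_pos.2 hN)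
    (fun a => pref (Alcove.colour a) (scale a)) fun a ha hsum => by
      simpa [scale, hN'] using hpref (Alcove.colour a) _ (hscale a ha hsum)
  refine ⟨fun c => scale (A.vertex c), fun c => hscale _ (hnonneg c) (A.sum_vertex c),
    fun c c' i => ?_, by simpa only [Alcove.full, Set.mem_ofPred_eq, A.colour_vertex] using hfull⟩
  simp only [scale]
  rw [← add_div]
  gcongr
  exact_mod_cast A.vertex_le_vertex_add_one c c' i

section Equilibrium

open Filter Topology

variable {ι : Type*}

theorem tendsto_of_forall_le_add {α : Type*} {l : Filter α} {z : α → ι → ι → ℝ} {ε : α → ℝ}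
    (hclose : ∀ t c c' i, z t c' i ≤ z t c i + ε t) (hε : Tendsto ε l (𝓝 0)) {y : ι → ℝ}
    {c₀ : ι} (hlim : Tendsto (fun t => z t c₀) l (𝓝 y)) (c : ι) :
    Tendsto (fun t => z t c) l (𝓝 y) := by
  refine tendsto_pi_nhds.2 fun i => ?_
  have hi := tendsto_pi_nhds.1 hlim i
  exact tendsto_of_tendsto_of_tendsto_of_le_of_le (by simpa using hi.sub hε)
    (by simpa using hi.add hε) (fun t => sub_le_iff_le_add.2 (hclose t c c₀ i))
    fun t => hclose t c₀ c i

variable [Fintype ι]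

theorem exists_bijective_label [Nonempty ι] {pref : ι → (ι → ℝ) → ι}
    (hpref : ∀ c, ∀ y ∈ stdSimplex ℝ ι, 0 < y (pref c y)) {N : ℕ} (hN : 0 < N) :
    ∃ z : ι → ι → ℝ, (∀ c, z c ∈ stdSimplex ℝ ι) ∧
      (∀ c c' i, z c' i ≤ z c i + 1 / N) ∧ Function.Bijective fun c => pref c (z c) := by
  have : NeZero (Fintype.card ι) := ⟨Fintype.card_ne_zero⟩
  let e : ι ≃ ZMod (Fintype.card ι) :=
    (Fintype.equivFin ι).trans (ZMod.finEquiv (Fintype.card ι)).toEquiv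
  have hmem (y : ZMod (Fintype.card ι) → ℝ) (hy : y ∈ stdSimplex ℝ (ZMod (Fintype.card ι))) :
      y ∘ e ∈ stdSimplex ℝ ι :=
    ⟨fun i => hy.1 _, (Equiv.sum_comp e y).trans hy.2⟩
  obtain ⟨z, hz, hclose, hbij⟩ := exists_bijective_label_zmod
    (pref := fun c y => e (pref (e.symm c) (y ∘ e)))
    (fun c y hy => hpref (e.symm c) _ (hmem y hy)) hN
  refine ⟨fun c => z (e c) ∘ e, fun c => hmem _ (hz _), fun c c' i => hclose _ _ _, ?_⟩
  simpa [Function.comp_def] using e.symm.bijective.comp (hbij.comp e.bijective)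

theorem exists_perm_forall_le [Nonempty ι] {U : ι → ι → (ι → ℝ) → ℝ}
    (hU : ∀ i j, ContinuousOn (U i j) (stdSimplex ℝ ι))
    (hpos : ∀ i, ∀ y ∈ stdSimplex ℝ ι, ∃ j, 0 < y j ∧ ∀ j', U i j' y ≤ U i j y) :
    ∃ y ∈ stdSimplex ℝ ι, ∃ σ : Equiv.Perm ι, ∀ i j, U i j y ≤ U i (σ i) y := by
  choose! pref hpref hbest using hpos
  choose z hz hclose hbij using fun t : ℕ => exists_bijective_label hpref t.succ_pos
  let c₀ := Classical.arbitrary ι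
  obtain ⟨y, hy, hlim⟩ := (isCompact_stdSimplex (𝕜 := ℝ) (ι := ι)).ultrafilter_le_nhds'
    ((hyperfilter ℕ).map fun t => z t c₀) (Ultrafilter.mem_map.2 (univ_mem' fun t => hz t c₀))
  have hinv : Tendsto (fun t : ℕ => 1 / ((t + 1 : ℕ) : ℝ)) (hyperfilter ℕ) (𝓝 0) := by
    simpa using
      (tendsto_one_div_add_atTop_nhds_zero_nat (𝕜 := ℝ)).mono_left Nat.hyperfilter_le_atTop
  have hlim' (c : ι) : Tendsto (fun t => z t c) (hyperfilter ℕ) (𝓝[stdSimplex ℝ ι] y) :=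
    tendsto_nhdsWithin_iff.2 ⟨tendsto_of_forall_le_add hclose hinv hlim c,
      Eventually.of_forall fun t => hz t c⟩
  obtain ⟨σ, hσ⟩ : ∃ σ : Equiv.Perm ι, ∀ᶠ t in hyperfilter ℕ, ∀ c, pref c (z t c) = σ c :=
    Ultrafilter.eventually_exists_iff.1 <| Eventually.of_forall fun t =>
      ⟨Equiv.ofBijective _ (hbij t), fun _ => rfl⟩
  refine ⟨y, hy, σ, fun i j => le_of_tendsto_of_tendsto ((hU i j y hy).tendsto.comp (hlim' i))
    ((hU i (σ i) y hy).tendsto.comp (hlim' i)) ?_⟩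
  filter_upwards [hσ] with t ht
  simpa only [Function.comp_apply, ht] using hbest i (z t i) (hz t i) j

end Equilibrium

/-! ### Envy-free divisions -/

section Cuts

variable {n : ℕ}

theorem partialSum_last {M : Type*} [AddCommMonoid M] (y : Fin n → M) :
    Fin.partialSum y (Fin.last n) = ∑ i, y i := by
  rw [Fin.partialSum, Fin.val_last, List.take_of_length_le (by simp), List.sum_ofFn]

theorem monotone_partialSum {M : Type*} [AddMonoid M] [Preorder M] [AddLeftMono M]
    {y : Fin n → M} (hy : ∀ i, 0 ≤ y i) : Monotone (Fin.partialSum y) :=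
  Fin.monotone_iff_le_succ.2 fun i => by
    rw [Fin.partialSum_succ]
    exact le_add_of_nonneg_right (hy i)

theorem continuous_partialSum {M : Type*} [AddMonoid M] [TopologicalSpace M] [ContinuousAdd M]
    (j : Fin (n + 1)) : Continuous fun y : Fin n → M => Fin.partialSum y j := by
  induction j using Fin.induction with
  | zero => simpa only [Fin.partialSum_zero] using continuous_const
  | succ j ih =>
    simp only [Fin.partialSum_succ]
    exact ih.add (continuous_apply j)

/-- A division of `[0, 1]` at the points `X` into consecutive pieces, where player `i` gets piece
number `σ i` and nobody prefers another player's piece. Here `V i a b` is the value of `[a, b]`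
to player `i`; it need not be additive. -/
structure IsEnvyFreeCut (V : Fin n → ℝ → ℝ → ℝ) (X : Fin (n + 1) → ℝ)
    (σ : Equiv.Perm (Fin n)) : Prop where
  monotone : Monotone X
  zero : X 0 = 0
  last : X (Fin.last n) = 1
  le : ∀ i s : Fin n, V i (X s.castSucc) (X s.succ) ≤ V i (X (σ i).castSucc) (X (σ i).succ)

theorem exists_isEnvyFreeCut [NeZero n] {V : Fin n → ℝ → ℝ → ℝ}
    (hcont : ∀ i, Continuous fun x : ℝ × ℝ => V i x.1 x.2) (hself : ∀ i a, V i a a ≤ 0)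
    (hpos : ∀ i, ∀ X : Fin (n + 1) → ℝ, Monotone X → X 0 = 0 → X (Fin.last n) = 1 →
      ∃ s : Fin n, 0 < V i (X s.castSucc) (X s.succ)) :
    ∃ X σ, IsEnvyFreeCut V X σ := by
  obtain ⟨y, ⟨hy, hsum⟩, σ, hσ⟩ := exists_perm_forall_le
    (U := fun i (s : Fin n) y => V i (Fin.partialSum y s.castSucc) (Fin.partialSum y s.succ))
    (fun i s => ((hcont i).comp
      ((continuous_partialSum s.castSucc).prodMk (continuous_partialSum s.succ))).continuousOn)
    fun i y ⟨hy, hsum⟩ => by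
      obtain ⟨t, ht⟩ := hpos i (Fin.partialSum y) (monotone_partialSum hy) (Fin.partialSum_zero y)
        ((partialSum_last y).trans hsum)
      obtain ⟨s, hs⟩ := Finite.exists_max fun s : Fin n =>
        V i (Fin.partialSum y s.castSucc) (Fin.partialSum y s.succ)
      refine ⟨s, (hy s).lt_of_ne' fun h0 => (ht.trans_le (hs t)).not_ge ?_, hs⟩
      rw [Fin.partialSum_succ, h0, add_zero]
      exact hself i _
  exact ⟨Fin.partialSum y, σ, monotone_partialSum hy, Fin.partialSum_zero y,
    (partialSum_last y).trans hsum, hσ⟩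

end Cuts

section Boosted

variable {F : ℝ → ℝ} {p q a b : ℝ}

/-- The value of `[a, b] ∩ [p, q]` under the distribution function `F`. -/
def overlap (F : ℝ → ℝ) (p q a b : ℝ) : ℝ :=
  F (max p (min q b)) - F (max p (min q a))

/-- The value of `[a, b]` under the distribution function `F`, in which the part inside `[p, q]`
counts twice as long as it is at most half of the value of `[p, q]`, and as the whole value of
`[p, q]` beyond. This anticipates the rounding of cuts inside `[p, q]` to `p` and `q`. -/
def boostedValue (F : ℝ → ℝ) (p q a b : ℝ) : ℝ :=
  F b - F a + min (F q - F p - overlap F p q a b) (overlap F p q a b)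

theorem continuous_boostedValue (hF : Continuous F) :
    Continuous fun x : ℝ × ℝ => boostedValue F p q x.1 x.2 := by
  unfold boostedValue overlap
  fun_prop

theorem max_min_eq_of_notMem_Ioo {x : ℝ} (hpq : p ≤ q) (hx : x ∉ Ioo p q) :
    x ≤ p ∧ max p (min q x) = p ∨ q ≤ x ∧ max p (min q x) = q := by
  rcases le_or_gt x p with hxp | hpx
  · exact Or.inl ⟨hxp, max_eq_left ((min_le_right q x).trans hxp)⟩
  · have hqx : q ≤ x := not_lt.1 fun h => hx ⟨hpx, h⟩
    exact Or.inr ⟨hqx, by rw [min_eq_left hqx, max_eq_right hpq]⟩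

theorem max_min_eq_of_mem_Ioo {x : ℝ} (hx : x ∈ Ioo p q) : max p (min q x) = x := by
  rw [min_eq_right hx.2.le, max_eq_right hx.1.le]

theorem overlap_le (hF : Monotone F) (hab : a ≤ b) : overlap F p q a b ≤ F b - F a := by
  unfold overlap
  rcases le_or_gt p b with hpb | hbp
  · have hb : F (max p (min q b)) ≤ F b := hF (max_le hpb (min_le_right q b))
    rcases le_or_gt a q with haq | hqa
    · have ha : F a ≤ F (max p (min q a)) := hF (le_max_of_le_right (le_min haq le_rfl))
      linarith
    · rw [min_eq_left (hqa.le.trans hab), min_eq_left hqa.le, sub_self, sub_nonneg]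
      exact hF hab
  · rw [max_eq_left ((min_le_right q b).trans hbp.le),
      max_eq_left ((min_le_right q a).trans (hab.trans hbp.le)), sub_self, sub_nonneg]
    exact hF hab

theorem le_boostedValue (hF : Monotone F) (hpq : p ≤ q) (hab : a ≤ b) :
    F b - F a ≤ boostedValue F p q a b := by
  have hb : F (max p (min q b)) ≤ F q := hF (max_le hpq (min_le_left _ _))
  have ha : F p ≤ F (max p (min q a)) := hF (le_max_left _ _)
  have hle : F (max p (min q a)) ≤ F (max p (min q b)) :=
    hF (max_le_max_left _ (min_le_min_left _ hab))
  rw [boostedValue, le_add_iff_nonneg_right, le_min_iff, overlap]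
  constructor <;> linarith

theorem boostedValue_le_two_mul (hF : Monotone F) (hab : a ≤ b) :
    boostedValue F p q a b ≤ 2 * (F b - F a) := by
  rw [boostedValue, two_mul]
  gcongr
  exact (min_le_right _ _).trans (overlap_le hF hab)

theorem le_boostedValue_of_le_two_mul_overlap (hF : Monotone F) (hab : a ≤ b)
    (h : F q - F p ≤ 2 * overlap F p q a b) : F q - F p ≤ boostedValue F p q a b := by
  have hle := overlap_le (p := p) (q := q) hF hab
  rw [boostedValue, min_eq_left (by linarith)]
  linarith

open Classical in
theorem boostedValue_le_rounded (hpq : p ≤ q) (hab : a ≤ b) :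
    boostedValue F p q a b ≤
      F (if b ∈ Ioo p q then q else b) - F (if a ∈ Ioo p q then p else a) := by
  have hleft := min_le_left (F q - F p - overlap F p q a b) (overlap F p q a b)
  have hright := min_le_right (F q - F p - overlap F p q a b) (overlap F p q a b)
  unfold boostedValue
  unfold overlap at hleft hright ⊢
  split_ifs with hb ha ha
  · rw [max_min_eq_of_mem_Ioo ha, max_min_eq_of_mem_Ioo hb] at hleft ⊢
    linarith
  · rw [max_min_eq_of_mem_Ioo hb] at hleft ⊢
    rcases max_min_eq_of_notMem_Ioo hpq ha with ⟨-, ha'⟩ | ⟨hqa, -⟩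
    · rw [ha'] at hleft ⊢
      linarith
    · exact absurd (hb.2.trans_le hqa) hab.not_gt
  · rw [max_min_eq_of_mem_Ioo ha] at hleft ⊢
    rcases max_min_eq_of_notMem_Ioo hpq hb with ⟨hbp, -⟩ | ⟨-, hb'⟩
    · exact absurd (hbp.trans_lt ha.1) hab.not_gt
    · rw [hb'] at hleft ⊢
      linarith
  · rcases max_min_eq_of_notMem_Ioo hpq ha with ⟨hap, ha'⟩ | ⟨hqa, ha'⟩ <;>
      rcases max_min_eq_of_notMem_Ioo hpq hb with ⟨hbp, hb'⟩ | ⟨hqb, hb'⟩ <;>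
      rw [ha', hb'] at hleft hright ⊢ <;> linarith

theorem exists_pos_boostedValue (hF : Monotone F) (hpq : p ≤ q) {n : ℕ} {X : Fin (n + 1) → ℝ}
    (hX : Monotone X) (h01 : F (X 0) < F (X (Fin.last n))) :
    ∃ s : Fin n, 0 < boostedValue F p q (X s.castSucc) (X s.succ) := by
  by_contra! hle
  have hanti : Antitone (F ∘ X) := Fin.antitone_iff_succ_le.2 fun s => sub_nonpos.1 <|
    (le_boostedValue hF hpq (hX Fin.castSucc_lt_succ.le)).trans (hle s)
  exact h01.not_ge (hanti (Fin.zero_le _))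

theorem exists_mem_Ico_castSucc_succ {n : ℕ} {X : Fin (n + 1) → ℝ} {x : ℝ}
    (hx : x ∈ Ico (X 0) (X (Fin.last n))) : ∃ s : Fin n, x ∈ Ico (X s.castSucc) (X s.succ) := by
  by_contra! h
  have hle (j : Fin (n + 1)) : X j ≤ x := by
    induction j using Fin.induction with
    | zero => exact hx.1
    | succ s ih => exact not_lt.1 fun hlt => h s ⟨ih, hlt⟩
  exact hx.2.not_ge (hle _)

/-- If only one cut falls inside `[p, q]`, one of its two sides contains half of the value. -/
theorem exists_le_two_mul_overlap_or_mem_Ioo {n : ℕ} {X : Fin (n + 1) → ℝ} (hF : Monotone F)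
    (hX : Monotone X) (hp : X 0 ≤ p) (hpq : p < q) (hq : q ≤ X (Fin.last n)) :
    (∃ s : Fin n, F q - F p ≤ 2 * overlap F p q (X s.castSucc) (X s.succ)) ∨
      ∃ s : Fin n, X s.castSucc ∈ Ioo p q ∧ X s.succ ∈ Ioo p q := by
  obtain ⟨s, hsp, hps⟩ := exists_mem_Ico_castSucc_succ ⟨hp, hpq.trans_le hq⟩
  have hclamp_left : max p (min q (X s.castSucc)) = p :=
    max_eq_left ((min_le_right _ _).trans hsp)
  rcases le_or_gt q (X s.succ) with hqs | hsq
  · refine Or.inl ⟨s, ?_⟩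
    rw [overlap, hclamp_left, min_eq_left hqs, max_eq_right hpq.le]
    linarith [hF hpq.le]
  obtain ⟨t, ht⟩ := Fin.exists_castSucc_eq.2 fun h : s.succ = Fin.last n =>
    (h ▸ hsq).not_ge hq
  rcases lt_or_ge (X t.succ) q with htq | hqt
  · exact Or.inr ⟨t, ht ▸ ⟨hps, hsq⟩, (ht ▸ hps).trans_le (hX t.castSucc_le_succ), htq⟩
  · have hadd : overlap F p q (X s.castSucc) (X s.succ) + overlap F p q (X t.castSucc) (X t.succ) =
        F q - F p := by
      rw [overlap, overlap, hclamp_left, ht, min_eq_left hqt, max_eq_right hpq.le]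
      ring
    rcases le_total (overlap F p q (X s.castSucc) (X s.succ))
      (overlap F p q (X t.castSucc) (X t.succ)) with h | h
    · exact Or.inl ⟨t, by linarith⟩
    · exact Or.inl ⟨s, by linarith⟩

end Boosted

/-! ### Rounding the cuts -/

section Rounding

variable {n : ℕ} {p q : Fin n → ℝ} {X : Fin (n + 1) → ℝ} {σ : Equiv.Perm (Fin n)}

open Classical in
/-- The cuts `X` after every player `i` whose piece (number `σ i`) has an end inside `(p i, q i)`
has moved that end outward, to `p i` or `q i`. -/
noncomputable def roundedCut (p q : Fin n → ℝ) (X : Fin (n + 1) → ℝ) (σ : Equiv.Perm (Fin n))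
    (j : Fin (n + 1)) : ℝ :=
  if h : ∃ i, (σ i).succ = j ∧ X j ∈ Ioo (p i) (q i) then q h.choose
  else if h : ∃ i, (σ i).castSucc = j ∧ X j ∈ Ioo (p i) (q i) then p h.choose
  else X j

theorem roundedCut_succ {i : Fin n} (hi : X (σ i).succ ∈ Ioo (p i) (q i)) :
    roundedCut p q X σ (σ i).succ = q i := by
  have hex : ∃ l, (σ l).succ = (σ i).succ ∧ X (σ i).succ ∈ Ioo (p l) (q l) := ⟨i, rfl, hi⟩
  rw [roundedCut, dif_pos hex, σ.injective (Fin.succ_injective _ hex.choose_spec.1)]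

theorem roundedCut_eq_or (p q : Fin n → ℝ) (X : Fin (n + 1) → ℝ) (σ : Equiv.Perm (Fin n))
    (j : Fin (n + 1)) :
    roundedCut p q X σ j = X j ∨ ∃ i, X j ∈ Ioo (p i) (q i) ∧
      ((σ i).succ = j ∧ roundedCut p q X σ j = q i ∨
        (σ i).castSucc = j ∧ roundedCut p q X σ j = p i) := by
  unfold roundedCut
  split_ifs with hsucc hcast
  · exact Or.inr ⟨_, hsucc.choose_spec.2, Or.inl ⟨hsucc.choose_spec.1, rfl⟩⟩
  · exact Or.inr ⟨_, hcast.choose_spec.2, Or.inr ⟨hcast.choose_spec.1, rfl⟩⟩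
  · exact Or.inl rfl

theorem roundedCut_of_forall_notMem {j : Fin (n + 1)} (hj : ∀ i, X j ∉ Ioo (p i) (q i)) :
    roundedCut p q X σ j = X j :=
  (roundedCut_eq_or p q X σ j).resolve_right fun ⟨i, hi, _⟩ => hj i hi

section Disjoint

variable (hdisj : Pairwise fun i l => Disjoint (Ioo (p i) (q i)) (Ioo (p l) (q l)))
include hdisj

theorem roundedCut_eq_or_of_mem {j : Fin (n + 1)} {i : Fin n} (hi : X j ∈ Ioo (p i) (q i)) :
    roundedCut p q X σ j = X j ∨ (σ i).succ = j ∧ roundedCut p q X σ j = q i ∨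
      (σ i).castSucc = j ∧ roundedCut p q X σ j = p i := by
  refine (roundedCut_eq_or p q X σ j).imp_right fun ⟨l, hl, h⟩ => ?_
  rwa [hdisj.eq (not_disjoint_iff.2 ⟨X j, hi, hl⟩)]

theorem roundedCut_castSucc {i : Fin n} (hi : X (σ i).castSucc ∈ Ioo (p i) (q i)) :
    roundedCut p q X σ (σ i).castSucc = p i := by
  have hsucc : ¬∃ l, (σ l).succ = (σ i).castSucc ∧ X (σ i).castSucc ∈ Ioo (p l) (q l) := by
    rintro ⟨l, hli, hl⟩
    rw [hdisj.eq (not_disjoint_iff.2 ⟨_, hl, hi⟩)] at hli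
    exact Fin.castSucc_lt_succ.ne' hli
  have hcast : ∃ l, (σ l).castSucc = (σ i).castSucc ∧ X (σ i).castSucc ∈ Ioo (p l) (q l) :=
    ⟨i, rfl, hi⟩
  rw [roundedCut, dif_neg hsucc, dif_pos hcast,
    σ.injective (Fin.castSucc_injective _ hcast.choose_spec.1)]

theorem roundedCut_mem_Icc {j : Fin (n + 1)} {i : Fin n} (hi : X j ∈ Ioo (p i) (q i)) :
    roundedCut p q X σ j ∈ Icc (p i) (q i) := by
  have hpq : p i ≤ q i := (hi.1.trans hi.2).le
  rcases roundedCut_eq_or_of_mem hdisj hi with h | ⟨-, h⟩ | ⟨-, h⟩ <;> rw [h]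
  exacts [Ioo_subset_Icc_self hi, right_mem_Icc.2 hpq, left_mem_Icc.2 hpq]

theorem roundedCut_le_of_ne {i s : Fin n} (hs : s ≠ σ i) (hi : X s.succ ∈ Ioo (p i) (q i)) :
    roundedCut p q X σ s.succ ≤ X s.succ := by
  rcases roundedCut_eq_or_of_mem hdisj hi with h | ⟨h, -⟩ | ⟨-, h⟩
  exacts [h.le, absurd (Fin.succ_injective _ h).symm hs, h.trans_le hi.1.le]

theorem le_roundedCut_of_ne {i s : Fin n} (hs : s ≠ σ i)
    (hi : X s.castSucc ∈ Ioo (p i) (q i)) : X s.castSucc ≤ roundedCut p q X σ s.castSucc := by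
  rcases roundedCut_eq_or_of_mem hdisj hi with h | ⟨-, h⟩ | ⟨h, -⟩
  exacts [h.ge, hi.2.le.trans h.ge, absurd (Fin.castSucc_injective _ h).symm hs]

variable (hpq : ∀ i, p i < q i)
include hpq

theorem le_roundedCut {j : Fin (n + 1)} {i : Fin n} (hj : q i ≤ X j) :
    q i ≤ roundedCut p q X σ j := by
  by_cases hmem : ∃ l, X j ∈ Ioo (p l) (q l)
  · obtain ⟨l, hl⟩ := hmem
    have hil : i ≠ l := by
      rintro rfl
      exact hl.2.not_ge hj
    have hsep := Ioo_disjoint_Ioo.1 (hdisj hil)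
    rw [min_eq_left (hj.trans hl.2.le)] at hsep
    exact ((le_max_iff.1 hsep).resolve_left (hpq i).not_ge).trans
      (roundedCut_mem_Icc hdisj hl).1
  · rwa [roundedCut_of_forall_notMem (not_exists.1 hmem)]

theorem monotone_roundedCut (hX : Monotone X)
    (hinside : ∀ i s, X s.castSucc ∈ Ioo (p i) (q i) → X s.succ ∈ Ioo (p i) (q i) → s = σ i) :
    Monotone (roundedCut p q X σ) := by
  refine Fin.monotone_iff_le_succ.2 fun s => ?_
  have hs : X s.castSucc ≤ X s.succ := hX s.castSucc_le_succ
  by_cases ha : ∃ i, X s.castSucc ∈ Ioo (p i) (q i)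
  · obtain ⟨i, hi⟩ := ha
    rcases lt_or_ge (X s.succ) (q i) with hlt | hge
    · have hi' : X s.succ ∈ Ioo (p i) (q i) := ⟨hi.1.trans_le hs, hlt⟩
      obtain rfl := hinside i s hi hi'
      rw [roundedCut_castSucc hdisj hi, roundedCut_succ hi']
      exact (hpq i).le
    · exact (roundedCut_mem_Icc hdisj hi).2.trans (le_roundedCut hdisj hpq hge)
  rw [roundedCut_of_forall_notMem (not_exists.1 ha)]
  by_cases hb : ∃ i, X s.succ ∈ Ioo (p i) (q i)
  · obtain ⟨i, hi⟩ := hb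
    have hsi : X s.castSucc ≤ p i :=
      not_lt.1 fun hlt => ha ⟨i, hlt, hs.trans_lt hi.2⟩
    exact hsi.trans (roundedCut_mem_Icc hdisj hi).1
  · rwa [roundedCut_of_forall_notMem (not_exists.1 hb)]

end Disjoint

theorem apply_roundedCut_of_notMem {G : ℝ → ℝ} (hG : Monotone G) {i : Fin n}
    (hzero : ∀ l, l ≠ i → G (p l) = G (q l)) {j : Fin (n + 1)} (hj : X j ∉ Ioo (p i) (q i)) :
    G (roundedCut p q X σ j) = G (X j) := by
  rcases roundedCut_eq_or p q X σ j with h | ⟨l, hl, h⟩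
  · rw [h]
  have hli : l ≠ i := by
    rintro rfl
    exact hj hl
  have hpl : G (p l) ≤ G (X j) := hG hl.1.le
  have hql : G (X j) ≤ G (q l) := hG hl.2.le
  have := hzero l hli
  rcases h with ⟨-, h⟩ | ⟨-, h⟩ <;> rw [h] <;> linarith

section Values

variable (hdisj : Pairwise fun i l => Disjoint (Ioo (p i) (q i)) (Ioo (p l) (q l)))

section OnePlayer

variable {G : ℝ → ℝ} (hG : Monotone G) {i : Fin n} (hzero : ∀ l, l ≠ i → G (p l) = G (q l))
include hdisj hG hzero

theorem sub_roundedCut_le_of_ne {s : Fin n} (hs : s ≠ σ i) :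
    G (roundedCut p q X σ s.succ) - G (roundedCut p q X σ s.castSucc) ≤
      G (X s.succ) - G (X s.castSucc) := by
  refine sub_le_sub ?_ ?_
  · by_cases h : X s.succ ∈ Ioo (p i) (q i)
    · exact hG (roundedCut_le_of_ne hdisj hs h)
    · exact (apply_roundedCut_of_notMem hG hzero h).le
  · by_cases h : X s.castSucc ∈ Ioo (p i) (q i)
    · exact hG (le_roundedCut_of_ne hdisj hs h)
    · exact (apply_roundedCut_of_notMem hG hzero h).ge

theorem boostedValue_le_sub_roundedCut (hpq : p i ≤ q i) (hX : Monotone X) :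
    boostedValue G (p i) (q i) (X (σ i).castSucc) (X (σ i).succ) ≤
      G (roundedCut p q X σ (σ i).succ) - G (roundedCut p q X σ (σ i).castSucc) := by
  refine (boostedValue_le_rounded hpq (hX (σ i).castSucc_le_succ)).trans_eq ?_
  congr 1
  · split_ifs with h
    · rw [roundedCut_succ h]
    · rw [apply_roundedCut_of_notMem hG hzero h]
  · split_ifs with h
    · rw [roundedCut_castSucc hdisj h]
    · rw [apply_roundedCut_of_notMem hG hzero h]

end OnePlayer

variable {F : Fin n → ℝ → ℝ} (hF : ∀ i, Monotone (F i)) (h01 : ∀ i, F i 0 < F i 1)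
  (hpq : ∀ i, p i < q i) (hzero : ∀ i l, l ≠ i → F i (p l) = F i (q l))
  (hX : IsEnvyFreeCut (fun i => boostedValue (F i) (p i) (q i)) X σ)
include hF h01 hpq hzero hX

/-- A piece inside `(p i, q i)` is worthless to everyone but `i`, whereas a favourite piece has
positive value. -/
theorem IsEnvyFreeCut.eq_of_mem_Ioo {i s : Fin n} (ha : X s.castSucc ∈ Ioo (p i) (q i))
    (hb : X s.succ ∈ Ioo (p i) (q i)) : s = σ i := by
  obtain ⟨l, rfl⟩ := σ.surjective s
  by_contra hne
  have hil : i ≠ l := fun h => hne (congrArg σ h.symm)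
  obtain ⟨t, ht⟩ := exists_pos_boostedValue (hF l) (hpq l).le hX.monotone
    (by rw [hX.zero, hX.last]; exact h01 l)
  have hpos := ht.trans_le (hX.le l t)
  have htwice := boostedValue_le_two_mul (p := p l) (q := q l) (hF l)
    (hX.monotone (σ l).castSucc_le_succ)
  have hconst := hzero l i hil
  have hpa := hF l ha.1.le
  have hbq := hF l hb.2.le
  linarith

include hdisj

theorem isEnvyFreeCut_roundedCut (hp : ∀ i, 0 ≤ p i) (hq : ∀ i, q i ≤ 1) :
    IsEnvyFreeCut (fun i a b => F i b - F i a) (roundedCut p q X σ) σ where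
  monotone := monotone_roundedCut hdisj hpq hX.monotone fun _ _ =>
    hX.eq_of_mem_Ioo hF h01 hpq hzero
  zero := by
    rw [roundedCut_of_forall_notMem fun i h => h.1.not_ge (hX.zero.trans_le (hp i)), hX.zero]
  last := by
    rw [roundedCut_of_forall_notMem fun i h => h.2.not_ge ((hq i).trans_eq hX.last.symm), hX.last]
  le i s := by
    rcases eq_or_ne s (σ i) with rfl | hs
    · rfl
    calc F i (roundedCut p q X σ s.succ) - F i (roundedCut p q X σ s.castSucc)
      _ ≤ F i (X s.succ) - F i (X s.castSucc) :=
        sub_roundedCut_le_of_ne hdisj (hF i) (hzero i) hs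
      _ ≤ boostedValue (F i) (p i) (q i) (X s.castSucc) (X s.succ) :=
        le_boostedValue (hF i) (hpq i).le (hX.monotone s.castSucc_le_succ)
      _ ≤ boostedValue (F i) (p i) (q i) (X (σ i).castSucc) (X (σ i).succ) := hX.le i s
      _ ≤ _ := boostedValue_le_sub_roundedCut hdisj (hF i) (hzero i) (hpq i).le hX.monotone

theorem IsEnvyFreeCut.le_sub_roundedCut (hp : ∀ i, 0 ≤ p i) (hq : ∀ i, q i ≤ 1) (i : Fin n) :
    F i (q i) - F i (p i) ≤
      F i (roundedCut p q X σ (σ i).succ) - F i (roundedCut p q X σ (σ i).castSucc) := by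
  rcases exists_le_two_mul_overlap_or_mem_Ioo (hF i) hX.monotone (hX.zero.trans_le (hp i)) (hpq i)
    ((hq i).trans_eq hX.last.symm) with ⟨s, hs⟩ | ⟨s, ha, hb⟩
  · calc F i (q i) - F i (p i)
      _ ≤ boostedValue (F i) (p i) (q i) (X s.castSucc) (X s.succ) :=
        le_boostedValue_of_le_two_mul_overlap (hF i) (hX.monotone s.castSucc_le_succ) hs
      _ ≤ boostedValue (F i) (p i) (q i) (X (σ i).castSucc) (X (σ i).succ) := hX.le i s
      _ ≤ _ := boostedValue_le_sub_roundedCut hdisj (hF i) (hzero i) (hpq i).le hX.monotone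
  · obtain rfl := hX.eq_of_mem_Ioo hF h01 hpq hzero ha hb
    rw [roundedCut_succ hb, roundedCut_castSucc hdisj ha]

end Values

end Rounding

theorem exists_isEnvyFreeCut_and_le {n : ℕ} [NeZero n] {F : Fin n → ℝ → ℝ}
    (hF : ∀ i, Monotone (F i)) (hcont : ∀ i, Continuous (F i)) (h01 : ∀ i, F i 0 < F i 1)
    {p q : Fin n → ℝ} (hp : ∀ i, 0 ≤ p i) (hpq : ∀ i, p i < q i) (hq : ∀ i, q i ≤ 1)
    (hdisj : Pairwise fun i l => Disjoint (Ioo (p i) (q i)) (Ioo (p l) (q l)))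
    (hzero : ∀ i l, l ≠ i → F i (p l) = F i (q l)) :
    ∃ Y σ, IsEnvyFreeCut (fun i a b => F i b - F i a) Y σ ∧
      ∀ i, F i (q i) - F i (p i) ≤ F i (Y (σ i).succ) - F i (Y (σ i).castSucc) := by
  obtain ⟨X, σ, hX⟩ := exists_isEnvyFreeCut
    (V := fun i => boostedValue (F i) (p i) (q i)) (fun i => continuous_boostedValue (hcont i))
    (fun i a => by simpa using boostedValue_le_two_mul (p := p i) (q := q i) (hF i) (le_refl a))
    fun i X hX h0 h1 => exists_pos_boostedValue (hF i) (hpq i).le hX (by rw [h0, h1]; exact h01 i)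
  exact ⟨roundedCut p q X σ, σ, isEnvyFreeCut_roundedCut hdisj hF h01 hpq hzero hX hp hq,
    hX.le_sub_roundedCut hdisj hF h01 hpq hzero hp hq⟩

/-! ### Allocations -/

section CutPiece

variable {n : ℕ} [NeZero n] {Y : Fin (n + 1) → ℝ} {x : ℝ} {s : Fin n}

open Classical in
/-- The number of the piece containing `x`, when the line is cut at the points `Y`. Points before
the first cut are counted as part of the first piece. -/
noncomputable def cutIndex (Y : Fin (n + 1) → ℝ) (x : ℝ) : Fin n :=
  (Finset.univ.filter fun s : Fin n => Y s.castSucc ≤ x).sup id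

/-- The piece number `s` of `[0, 1]`, when cut at the points `Y`. It is half-open unless it is the
last one, so that distinct pieces are disjoint. -/
def cutPiece (Y : Fin (n + 1) → ℝ) (s : Fin n) : Set ℝ :=
  Icc 0 1 ∩ cutIndex Y ⁻¹' {s}

theorem monotone_cutIndex (Y : Fin (n + 1) → ℝ) : Monotone (cutIndex Y) := fun _ _ hxy =>
  Finset.sup_mono (Finset.monotone_filter_right _ fun _ _ hs => le_trans hs hxy)

theorem isContiguousAllocation_cutPiece (Y : Fin (n + 1) → ℝ) (σ : Equiv.Perm (Fin n)) :
    IsContiguousAllocation fun i => cutPiece Y (σ i) where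
  ordConnected i := ordConnected_Icc.inter
    (ordConnected_singleton.preimage_mono (monotone_cutIndex Y))
  disjoint i j hij := ((disjoint_singleton.2 (σ.injective.ne hij)).preimage _).mono
    inter_subset_right inter_subset_right
  iUnion_eq := by
    simp only [cutPiece]
    rw [← inter_iUnion, σ.surjective.iUnion_comp fun s => cutIndex Y ⁻¹' {s}, ← preimage_iUnion,
      iUnion_of_singleton, preimage_univ, inter_univ]

theorem cutIndex_eq (hY : Monotone Y) (hx : x ∈ Ico (Y s.castSucc) (Y s.succ)) :
    cutIndex Y x = s := by
  classical
  refine le_antisymm (Finset.sup_le fun t ht => ?_)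
    (Finset.le_sup (f := id) (Finset.mem_filter.2 ⟨Finset.mem_univ s, hx.1⟩))
  exact not_lt.1 fun hst => (hx.2.trans_le (hY (Fin.succ_le_castSucc_iff.2 hst))).not_ge
    (Finset.mem_filter.1 ht).2

theorem cutPiece_ae_eq (μ : Measure ℝ) [NullSingletonClass μ] (hY : Monotone Y) (h0 : Y 0 = 0)
    (h1 : Y (Fin.last n) = 1) (s : Fin n) :
    cutPiece Y s =ᵐ[μ] Icc (Y s.castSucc) (Y s.succ) := by
  have hinner : Ico (Y s.castSucc) (Y s.succ) ⊆ cutPiece Y s := fun x hx =>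
    ⟨⟨h0 ▸ (hY (Fin.zero_le _)).trans hx.1, h1 ▸ hx.2.le.trans (hY (Fin.le_last _))⟩,
      cutIndex_eq hY hx⟩
  have houter : cutPiece Y s \ {1} ⊆ Ico (Y s.castSucc) (Y s.succ) := by
    rintro x ⟨⟨hx, rfl⟩, hx1⟩
    obtain ⟨t, ht⟩ := exists_mem_Ico_castSucc_succ (X := Y) (x := x)
      ⟨h0 ▸ hx.1, h1 ▸ hx.2.lt_of_ne hx1⟩
    rwa [cutIndex_eq hY ht]
  exact ((sdiff_null_ae_eq_self (measure_singleton 1)).symm.le.trans houter.eventuallyLE).antisymm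
    hinner.eventuallyLE |>.trans Ico_ae_eq_Icc

end CutPiece

section DistributionFunction

variable (μ : Measure ℝ) [IsLocallyFiniteMeasure μ]

/-- The distribution function of `μ`, normalized to vanish at `0`. -/
noncomputable def distribution (μ : Measure ℝ) (x : ℝ) : ℝ :=
  ∫ _ in 0..x, (1 : ℝ) ∂μ

theorem distribution_sub {a b : ℝ} (hab : a ≤ b) :
    distribution μ b - distribution μ a = μ.real (Ioc a b) := by
  rw [distribution, distribution, intervalIntegral.integral_interval_sub_left
    intervalIntegrable_const intervalIntegrable_const, intervalIntegral.integral_of_le hab,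
    setIntegral_const, smul_eq_mul, mul_one]

theorem monotone_distribution : Monotone (distribution μ) := fun _ _ hab =>
  sub_nonneg.1 <| distribution_sub μ hab ▸ measureReal_nonneg

variable [NullSingletonClass μ]

theorem continuous_distribution : Continuous (distribution μ) :=
  intervalIntegral.continuous_primitive (fun _ _ => intervalIntegrable_const) 0

theorem measureReal_Icc_eq_distribution_sub {a b : ℝ} (hab : a ≤ b) :
    μ.real (Icc a b) = distribution μ b - distribution μ a := by
  rw [distribution_sub μ hab, measureReal_congr Ioc_ae_eq_Icc]

end DistributionFunction

theorem IsEnvyFreeCut.measureReal_cutPiece {n : ℕ} [NeZero n] {V : Fin n → ℝ → ℝ → ℝ}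
    {Y : Fin (n + 1) → ℝ} {σ : Equiv.Perm (Fin n)} (hY : IsEnvyFreeCut V Y σ) (μ : Measure ℝ)
    [IsLocallyFiniteMeasure μ] [NullSingletonClass μ] (s : Fin n) :
    μ.real (cutPiece Y s) = distribution μ (Y s.succ) - distribution μ (Y s.castSucc) := by
  rw [measureReal_congr (cutPiece_ae_eq μ hY.monotone hY.zero hY.last s),
    measureReal_Icc_eq_distribution_sub μ (hY.monotone Fin.castSucc_lt_succ.le)]

theorem lemma3p17_general {n : ℕ} [NeZero n] (μ : Fin n → Measure ℝ)
    [∀ i, IsLocallyFiniteMeasure (μ i)] [∀ i, NullSingletonClass (μ i)]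
    (hμ : ∀ i, μ i (Icc 0 1) ≠ 0)
    {p q : Fin n → ℝ} (hp : ∀ i, 0 ≤ p i) (hpq : ∀ i, p i < q i) (hq : ∀ i, q i ≤ 1)
    (hdisj : Pairwise fun i l => Disjoint (Ioo (p i) (q i)) (Ioo (p l) (q l)))
    (hzero : ∀ i l, l ≠ i → μ i (Icc (p l) (q l)) = 0) :
    ∃ A : Fin n → Set ℝ, IsContiguousAllocation A ∧
      (∀ i j, (μ i).real (A j) ≤ (μ i).real (A i)) ∧
      ∀ i, (μ i).real (Icc (p i) (q i)) ≤ (μ i).real (A i) := by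
  have h01 (i : Fin n) : distribution (μ i) 0 < distribution (μ i) 1 := by
    rw [← sub_pos, ← measureReal_Icc_eq_distribution_sub _ zero_le_one]
    exact measureReal_nonneg.lt_of_ne'
      ((measureReal_ne_zero_iff isCompact_Icc.measure_lt_top.ne).2 (hμ i))
  have hconst (i l : Fin n) (hl : l ≠ i) :
      distribution (μ i) (p l) = distribution (μ i) (q l) := by
    rw [eq_comm, ← sub_eq_zero, ← measureReal_Icc_eq_distribution_sub _ (hpq l).le,
      measureReal_def, hzero i l hl, ENNReal.toReal_zero]
  obtain ⟨Y, σ, hY, hown⟩ := exists_isEnvyFreeCut_and_le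
    (fun i => monotone_distribution (μ i)) (fun i => continuous_distribution (μ i)) h01 hp hpq hq
    hdisj hconst
  refine ⟨fun i => cutPiece Y (σ i), isContiguousAllocation_cutPiece Y σ, fun i j => ?_,
    fun i => ?_⟩
  · simpa only [hY.measureReal_cutPiece] using hY.le i (σ j)
  · simpa only [hY.measureReal_cutPiece, measureReal_Icc_eq_distribution_sub _ (hpq i).le]
      using hown i

namespace CakeInstance

variable {n k : ℕ} (I : CakeInstance n)

/-- The value of player `i` as a measure on the line that is supported on the cake. -/
noncomputable def valueMeasure (i : Fin n) : Measure ℝ :=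
  (volume.restrict (Icc 0 1)).withDensity fun x => ENNReal.ofReal (I.density i x)

theorem integrableOn_density (i : Fin n) : IntegrableOn (I.density i) (Icc 0 1) :=
  (I.continuousOn_density i).integrableOn_compact isCompact_Icc

instance (i : Fin n) : IsFiniteMeasure (I.valueMeasure i) :=
  isFiniteMeasure_withDensity_ofReal (I.integrableOn_density i).2

instance (i : Fin n) : NullSingletonClass (I.valueMeasure i) :=
  nullSingletonClass_withDensity _

theorem value_eq_measureReal (i : Fin n) {S : Set ℝ} (hS : S ⊆ Icc 0 1) :
    I.value i S = (I.valueMeasure i).real S := by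
  have hnonneg : 0 ≤ᵐ[volume.restrict S] I.density i :=
    ae_restrict_of_ae_restrict_of_subset hS
      (ae_restrict_of_forall_mem measurableSet_Icc (I.density_nonneg i))
  rw [value, integral_eq_lintegral_of_nonneg_ae hnonneg
    ((I.integrableOn_density i).mono_set hS).1, measureReal_def, valueMeasure, withDensity_apply',
    Measure.restrict_restrict_of_subset hS]

theorem valueMeasure_Icc_ne_zero (i : Fin n) : I.valueMeasure i (Icc 0 1) ≠ 0 := by
  rw [← measureReal_ne_zero_iff, ← I.value_eq_measureReal i Subset.rfl, value, I.integral_density]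
  exact one_ne_zero

namespace OwnedPieces

variable {I} (P : I.OwnedPieces k)
include P

theorem mul_ne_zero : n * k ≠ 0 := by
  intro h
  have : IsEmpty (Fin (n * k)) := by rw [h]; infer_instance
  have hlast : (0 : Fin (n * k + 1)) = Fin.last (n * k) := Fin.ext h.symm
  exact zero_ne_one (P.bdry_zero.symm.trans ((congrArg P.bdry hlast).trans P.bdry_last))

theorem exists_value_piece_eq_maxPieceValue (i : Fin n) :
    ∃ m, I.value i (P.piece i m) = P.maxPieceValue i :=
  have : NeZero k := ⟨right_ne_zero_of_mul P.mul_ne_zero⟩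
  exists_eq_ciSup_of_finite

theorem bdry_mem_Icc (j : Fin (n * k + 1)) : P.bdry j ∈ Icc (0 : ℝ) 1 :=
  ⟨P.bdry_zero ▸ P.strictMono_bdry.monotone (Fin.zero_le j),
    P.bdry_last ▸ P.strictMono_bdry.monotone (Fin.le_last j)⟩

theorem piece_subset_Icc (i : Fin n) (m : Fin k) : P.piece i m ⊆ Icc 0 1 :=
  Icc_subset_Icc (P.bdry_mem_Icc _).1 (P.bdry_mem_Icc _).2

theorem disjoint_Ioo_bdry {r s : Fin (n * k)} (hrs : r ≠ s) :
    Disjoint (Ioo (P.bdry r.castSucc) (P.bdry r.succ))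
      (Ioo (P.bdry s.castSucc) (P.bdry s.succ)) := by
  rw [Ioo_disjoint_Ioo]
  rcases hrs.lt_or_gt with h | h
  · exact (min_le_left _ _).trans ((P.strictMono_bdry.monotone
      (Fin.succ_le_castSucc_iff.2 h)).trans (le_max_right _ _))
  · exact (min_le_right _ _).trans ((P.strictMono_bdry.monotone
      (Fin.succ_le_castSucc_iff.2 h)).trans (le_max_left _ _))

theorem valueMeasure_piece_eq_zero {i l : Fin n} (hl : l ≠ i) (m : Fin k) :
    I.valueMeasure l (P.piece i m) = 0 := by
  rw [← measureReal_eq_zero_iff, ← I.value_eq_measureReal l (P.piece_subset_Icc i m)]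
  exact P.value_eq_zero i m l hl

end OwnedPieces

end CakeInstance

theorem lemma3p17 {n k : ℕ} (I : CakeInstance n) (P : I.OwnedPieces k) :
    ∃ A : Fin n → Set ℝ, IsContiguousAllocation A ∧ I.EnvyFree A ∧
      ∀ i, P.maxPieceValue i ≤ I.value i (A i) := by
  have : NeZero n := ⟨left_ne_zero_of_mul P.mul_ne_zero⟩
  choose m hm using P.exists_value_piece_eq_maxPieceValue
  obtain ⟨A, hA, henvy, hown⟩ := lemma3p17_general I.valueMeasure I.valueMeasure_Icc_ne_zero
    (fun i => (P.bdry_mem_Icc (P.pos (i, m i)).castSucc).1)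
    (fun i => P.strictMono_bdry Fin.castSucc_lt_succ)
    (fun i => (P.bdry_mem_Icc (P.pos (i, m i)).succ).2)
    (fun i l hil => P.disjoint_Ioo_bdry (P.pos.injective.ne fun h => hil (congrArg Prod.fst h)))
    fun i l hl => P.valueMeasure_piece_eq_zero hl.symm (m l)
  have hvalue (i j : Fin n) : I.value i (A j) = (I.valueMeasure i).real (A j) :=
    I.value_eq_measureReal i (hA.iUnion_eq ▸ subset_iUnion A j)
  refine ⟨A, hA, fun i j => ?_, fun i => ?_⟩
  · simpa only [hvalue] using henvy i j
  · rw [← hm i, hvalue, I.value_eq_measureReal i (P.piece_subset_Icc i (m i))]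
    exact hown i
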